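/- Let $w=(w_1,w_2)$ with positive integers $w_1,w_2$, and put $\tilde w=\max\{w_1,w_2\}$. For a nonzero polynomial $h=\sum c_{a,b}x^ay^b\in\mathbb{C}[x,y]$ let $\deg_w h=\max\{aw_1+bw_2 : c_{a,b}\neq 0\}$, and for a polynomial automorphism $F=(F_1,F_2)$ of $\mathbb{C}^2$ let $\deg_w F=(\deg_w F_1,\deg_w F_2)$. Every polynomial automorphism $F$ of $\mathbb{C}^2$ can be written as $F=L_2\circ T_l\circ\cdots\circ T_1\circ L_1$ with $l\ge 0$, affine automorphisms $L_1,L_2$ of $\mathbb{C}^2$, and $T_i(x,y)=(x,y+f_i(x))$ for odd $i$, $T_i(x,y)=(x+f_i(y),y)$ for even $i$, where the $f_i\in\mathbb{C}[t]$ are univariate polynomials with $\deg f_i>1$; the number $l$ is uniquely determined by $F$ and is called the length of $F$. If $F$ is a polynomial automorphism of $\mathbb{C}^2$ of length at most $1$, then $\deg_w F$ is an element of the set $$\{(w_1,kw_1),(kw_1,w_1),(kw_1,kw_1) : k\in\mathbb{Z}_{\ge 1},\ kw_1\ge w_2\}$$ $$\cup\ \{(w_2,kw_2),(kw_2,w_2),(kw_2,kw_2)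 : k\in\mathbb{Z}_{\ge 1},\ kw_2\ge w_1\}$$ $$\cup\ \{(w_1,w_2),(w_2,w_1),(\tilde w,\tilde w)\}.$$ -/

import Mathlib

/-- Polynomial mappings `ℂⁿ → ℂⁿ`, given by their coordinate polynomials
(coordinates are numbered from `0`). -/
abbrev PolyMap (n : ℕ) : Type := Fin n → MvPolynomial (Fin n) ℂ

namespace PolyMap

/-- The map `ℂⁿ → ℂⁿ` defined by the coordinate polynomials. -/
noncomputable def toFun {n : ℕ} (F : PolyMap n) (z : Fin n → ℂ) : Fin n → ℂ :=
  fun i => MvPolynomial.eval z (F i)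

/-- The identity mapping `(x₁, …, xₙ)`. -/
noncomputable def id (n : ℕ) : PolyMap n := fun i => MvPolynomial.X i

/-- The composition `G ∘ F`: substitute the coordinates of `F` into those of `G`. -/
noncomputable def comp {n : ℕ} (G F : PolyMap n) : PolyMap n :=
  fun i => MvPolynomial.bind₁ F (G i)

/-- `comp` is composition of the underlying maps. -/
theorem toFun_comp {n : ℕ} (G F : PolyMap n) (z : Fin n → ℂ) :
    (G.comp F).toFun z = G.toFun (F.toFun z) := by
  funext i
  simp only [toFun, comp]
  exact MvPolynomial.eval₂Hom_bind₁ _ _ _ _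

/-- Polynomial automorphisms of `ℂⁿ`: polynomial mappings with a polynomial inverse. -/
def IsAut {n : ℕ} (F : PolyMap n) : Prop :=
  ∃ G : PolyMap n, G.comp F = id n ∧ F.comp G = id n

/-- Affine mappings: every coordinate has degree `1`. -/
def IsAffine {n : ℕ} (F : PolyMap n) : Prop :=
  ∀ i, (F i).totalDegree = 1

/-- The triangular automorphism `(x, y) ↦ (x, y + f(x))`. -/
noncomputable def lowerTriangular (f : Polynomial ℂ) : PolyMap 2 :=
  ![MvPolynomial.X 0, MvPolynomial.X 1 + Polynomial.aeval (MvPolynomial.X 0) f]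

/-- The triangular automorphism `(x, y) ↦ (x + f(y), y)`. -/
noncomputable def upperTriangular (f : Polynomial ℂ) : PolyMap 2 :=
  ![MvPolynomial.X 0 + Polynomial.aeval (MvPolynomial.X 1) f, MvPolynomial.X 1]

/-- `alternating f l = T_l ∘ ⋯ ∘ T_1`, where `T_i` is `(x, y) ↦ (x, y + f_i(x))` for odd `i`
and `(x, y) ↦ (x + f_i(y), y)` for even `i`. -/
noncomputable def alternating (f : ℕ → Polynomial ℂ) : ℕ → PolyMap 2
  | 0 => id 2
  | l + 1 =>
    (if Odd (l + 1) then lowerTriangular (f (l + 1)) else upperTriangular (f (l + 1))).comp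
      (alternating f l)

/-- `F = L₂ ∘ T_l ∘ ⋯ ∘ T_1 ∘ L₁` with affine automorphisms `L₁, L₂` and alternating triangular
automorphisms `T_1, …, T_l` given by univariate polynomials `f_1, …, f_l` of degree `> 1`. -/
def HasDecomposition (F : PolyMap 2) (l : ℕ) : Prop :=
  ∃ (L₁ L₂ : PolyMap 2) (f : ℕ → Polynomial ℂ),
    (L₁.IsAffine ∧ L₁.IsAut) ∧ (L₂.IsAffine ∧ L₂.IsAut) ∧
    (∀ i ∈ Finset.Icc 1 l, 1 < (f i).natDegree) ∧
    F = L₂.comp ((alternating f l).comp L₁)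

/-- The length of `F`: the number `l` of triangular factors in a decomposition as in
`HasDecomposition`. For an automorphism of `ℂ²` such an `l` exists and is unique; so that the
definition does not depend on this fact, the least `l` is taken, and `⊤` if there is none. -/
noncomputable def length (F : PolyMap 2) : ℕ∞ :=
  ⨅ (l : ℕ) (_ : F.HasDecomposition l), (l : ℕ∞)

/-- The weighted bidegree of `F` with respect to the weights `w₁` of `x` and `w₂` of `y`. -/
noncomputable def weightedBidegree (w₁ w₂ : ℕ) (F : PolyMap 2) : ℕ × ℕ :=
  ((F 0).weightedTotalDegree ![w₁, w₂], (F 1).weightedTotalDegree ![w₁, w₂])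

end PolyMap

/-! A map of length at most 1 is affine, or each coordinate has the form `b + β f(u)` with `b`, `u`
affine, `u` the first coordinate of `L₁`, and `n = deg f > 1`. If `β = 0`, the coordinate is a
nonzero multiple of `u` plus a constant, of weighted degree `E = deg_w u`. If `β ≠ 0`, its degree
`D` is the maximum over the variables of `n * w i` or `w i`, according to whether `u` involves the
variable. The upper bound for `D` is subadditivity; the lower bound restricts to each coordinate
axis, where `f(u)` has degree `n` and cannot be cancelled by `b`, or is constant and leaves the
linear term of `b` (`mul_le_weightedTotalDegree_of_coeff_aeval_single`). Invertibility of `L₂`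
excludes the bidegree `(E, E)`, and comparing `E` with `D` gives the listed pairs. -/

namespace MvPolynomial

variable {σ R : Type*} [CommSemiring R]

/-! ### Subadditivity of the weighted degree -/

theorem weightedTotalDegree_add_le (w : σ → ℕ) (p q : MvPolynomial σ R) :
    weightedTotalDegree w (p + q) ≤ max (weightedTotalDegree w p) (weightedTotalDegree w q) := by
  classical
  refine Finset.sup_le fun m hm => ?_
  rcases Finset.mem_union.1 (support_add hm) with h | h
  · exact le_max_of_le_left (le_weightedTotalDegree w h)
  · exact le_max_of_le_right (le_weightedTotalDegree w h)

theorem weightedTotalDegree_mul_le (w : σ → ℕ) (p q : MvPolynomial σ R) :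
    weightedTotalDegree w (p * q) ≤ weightedTotalDegree w p + weightedTotalDegree w q := by
  classical
  refine Finset.sup_le fun m hm => ?_
  obtain ⟨s, hs, t, ht, rfl⟩ := Finset.mem_add.1 (support_mul p q hm)
  rw [map_add]
  exact add_le_add (le_weightedTotalDegree w hs) (le_weightedTotalDegree w ht)

theorem weightedTotalDegree_C (w : σ → ℕ) (c : R) : weightedTotalDegree w (C c) = 0 := by
  classical
  refine Nat.le_zero.1 (Finset.sup_le fun m hm => ?_)
  rw [support_C] at hm
  split_ifs at hm <;> simp_all

theorem weightedTotalDegree_X_le (w : σ → ℕ) (i : σ) :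
    weightedTotalDegree w (X i : MvPolynomial σ R) ≤ w i := by
  refine Finset.sup_le fun m hm => ?_
  have : m = Finsupp.single i 1 := by
    simpa using support_monomial_subset hm
  simp [this, Finsupp.weight_apply]

theorem weightedTotalDegree_pow_le (w : σ → ℕ) (p : MvPolynomial σ R) (n : ℕ) :
    weightedTotalDegree w (p ^ n) ≤ n * weightedTotalDegree w p := by
  induction n with
  | zero => simpa using (weightedTotalDegree_C (R := R) w 1).le
  | succ n ih =>
    rw [pow_succ, Nat.succ_mul]
    exact (weightedTotalDegree_mul_le _ _ _).trans (Nat.add_le_add_right ih _)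

theorem weightedTotalDegree_C_mul_le (w : σ → ℕ) (c : R) (p : MvPolynomial σ R) :
    weightedTotalDegree w (C c * p) ≤ weightedTotalDegree w p := by
  simpa [weightedTotalDegree_C] using weightedTotalDegree_mul_le w (C c) p

theorem weightedTotalDegree_sum_le {ι : Type*} (w : σ → ℕ) (s : Finset ι)
    (p : ι → MvPolynomial σ R) {N : ℕ} (h : ∀ i ∈ s, weightedTotalDegree w (p i) ≤ N) :
    weightedTotalDegree w (∑ i ∈ s, p i) ≤ N := by
  classical
  induction s using Finset.induction_on with
  | empty => simp [weightedTotalDegree_zero]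
  | insert i s hi ih =>
    rw [Finset.sum_insert hi]
    exact (weightedTotalDegree_add_le _ _ _).trans
      (max_le (h i (by simp)) (ih fun j hj => h j (by simp [hj])))

theorem weightedTotalDegree_aeval_le (w : σ → ℕ) (f : Polynomial R) (p : MvPolynomial σ R) :
    weightedTotalDegree w (Polynomial.aeval p f) ≤ f.natDegree * weightedTotalDegree w p := by
  rw [Polynomial.aeval_eq_sum_range]
  refine weightedTotalDegree_sum_le _ _ _ fun n hn => ?_
  rw [smul_eq_C_mul]
  exact (weightedTotalDegree_C_mul_le _ _ _).trans ((weightedTotalDegree_pow_le _ _ _).trans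
    (Nat.mul_le_mul_right _ (Finset.mem_range_succ_iff.1 hn)))

/-- Restricting to the `i`-th coordinate axis bounds the weighted total degree from below. -/
theorem mul_le_weightedTotalDegree_of_coeff_aeval_single [Fintype σ] [DecidableEq σ] (w : σ → ℕ)
    (p : MvPolynomial σ R) (i : σ) (n : ℕ)
    (h : (aeval (Pi.single i Polynomial.X : σ → Polynomial R) p).coeff n ≠ 0) :
    n * w i ≤ weightedTotalDegree w p := by
  rw [aeval_def, eval₂_eq', Polynomial.finsetSum_coeff] at h
  obtain ⟨m, hm, hne⟩ := Finset.exists_ne_zero_of_sum_ne_zero h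
  -- A monomial involving another variable vanishes on the axis.
  have hm' : ∀ j ≠ i, m j = 0 := by
    intro j hj
    by_contra h0
    refine hne ?_
    rw [Finset.prod_eq_zero (Finset.mem_univ j) (by simp [hj, h0])]
    simp
  have hprod : ∏ j, (Pi.single i Polynomial.X : σ → Polynomial R) j ^ m j = Polynomial.X ^ m i := by
    rw [Finset.prod_eq_single i (fun j _ hj => by simp [hm' j hj]) (by simp)]
    simp
  have hn : n = m i := by
    by_contra h0
    exact hne (by rw [hprod]; simp [Polynomial.coeff_X_pow, h0])
  refine le_trans ?_ (le_weightedTotalDegree w hm)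
  rw [Finsupp.weight_apply, Finsupp.sum_fintype _ _ (by simp), hn]
  exact Finset.single_le_sum (f := fun j => m j • w j) (by simp) (Finset.mem_univ i)

/-! ### Affine forms -/

/-- The polynomial `∑ aᵢ xᵢ + c` of degree at most `1`. -/
noncomputable def affineForm [Fintype σ] (a : σ → R) (c : R) : MvPolynomial σ R :=
  ∑ i, C (a i) * X i + C c

theorem eq_affineForm_of_totalDegree_le_one [Fintype σ] {p : MvPolynomial σ R}
    (hp : p.totalDegree ≤ 1) :
    p = affineForm (fun i => coeff (Finsupp.single i 1) p) (coeff 0 p) := by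
  classical
  ext m
  simp only [affineForm, coeff_add, coeff_sum, coeff_C_mul, coeff_X, coeff_C]
  by_cases h0 : m = 0
  · subst h0
    simp [Finsupp.single_eq_zero]
  · rw [if_neg (Ne.symm h0), add_zero]
    by_cases h1 : ∃ i, m = Finsupp.single i 1
    · obtain ⟨i, rfl⟩ := h1
      rw [Finset.sum_eq_single i] <;> simp +contextual [Finsupp.single_left_inj]
    · push Not at h1
      rw [Finset.sum_eq_zero fun i _ => by simp [(h1 i).symm]]
      by_contra hc
      have h2 : m.sum (fun _ e => e) ≤ 1 := (le_totalDegree (mem_support_iff.2 hc)).trans hp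
      have h3 : m.sum (fun _ e => e) ≠ 1 := fun h => by
        obtain ⟨i, hi⟩ := (Finsupp.sum_eq_one_iff m).1 h
        exact h1 i hi
      have h4 : m.sum (fun _ e => e) = 0 := by omega
      rw [Finsupp.sum_fintype _ _ (by simp)] at h4
      exact h0 (Finsupp.ext fun i => by simpa using (Finset.sum_eq_zero_iff.1 h4) i)

theorem weightedTotalDegree_affineForm_le [Fintype σ] (w : σ → ℕ) (a : σ → R) (c : R) {N : ℕ}
    (h : ∀ i, a i ≠ 0 → w i ≤ N) : weightedTotalDegree w (affineForm a c) ≤ N := by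
  refine (weightedTotalDegree_add_le _ _ _).trans (max_le ?_ (by simp [weightedTotalDegree_C]))
  refine weightedTotalDegree_sum_le _ _ _ fun i _ => ?_
  by_cases ha : a i = 0
  · simp [ha, weightedTotalDegree_zero]
  · exact (weightedTotalDegree_C_mul_le _ _ _).trans
      ((weightedTotalDegree_X_le _ _).trans (h i ha))

theorem aeval_single_affineForm [Fintype σ] [DecidableEq σ] (a : σ → R) (c : R) (i : σ) :
    aeval (Pi.single i Polynomial.X : σ → Polynomial R) (affineForm a c) =
      Polynomial.C (a i) * Polynomial.X + Polynomial.C c := by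
  simp only [affineForm, map_add, map_sum, map_mul, aeval_C, aeval_X]
  rw [Finset.sum_eq_single i (fun j _ hj => by simp [hj]) (by simp)]
  simp

theorem le_weightedTotalDegree_affineForm [Fintype σ] (w : σ → ℕ) (a : σ → R) (c : R) {i : σ}
    (h : a i ≠ 0) : w i ≤ weightedTotalDegree w (affineForm a c) := by
  classical
  simpa using mul_le_weightedTotalDegree_of_coeff_aeval_single w (affineForm a c) i 1
    (by simpa [aeval_single_affineForm] using h)

theorem bind₁_affineForm [Fintype σ] {τ : Type*} (G : σ → MvPolynomial τ R) (a : σ → R) (c : R) :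
    bind₁ G (affineForm a c) = ∑ i, C (a i) * G i + C c := by
  simp [affineForm]

/-! ### Degree of `b + β f(u)` for affine `b` and `u` -/

section Field

variable {K : Type*} [Field K] [Fintype σ]

/-- On the `i`-th axis `u` is linear and nonconstant, so `f(u)` keeps degree `deg f > 1`, out of
reach of the affine summand. -/
theorem natDegree_mul_le_weightedTotalDegree (w : σ → ℕ) (a b : σ → K) (c d β : K)
    (f : Polynomial K) (hβ : β ≠ 0) (hf : 1 < f.natDegree) {i : σ} (ha : a i ≠ 0) :
    f.natDegree * w i ≤
      weightedTotalDegree w (affineForm b d + C β * Polynomial.aeval (affineForm a c) f) := by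
  classical
  refine mul_le_weightedTotalDegree_of_coeff_aeval_single w _ i _ ?_
  set u : Polynomial K := Polynomial.C (a i) * Polynomial.X + Polynomial.C c with hu
  have hu1 : u.natDegree = 1 := Polynomial.natDegree_linear ha
  have hcomp : (f.comp u).natDegree = f.natDegree := by
    rw [Polynomial.natDegree_comp, hu1, mul_one]
  have hlin : (Polynomial.C (b i) * Polynomial.X + Polynomial.C d).coeff f.natDegree = 0 :=
    Polynomial.coeff_eq_zero_of_natDegree_lt (Polynomial.natDegree_linear_le.trans_lt hf)
  have hne : f.comp u ≠ 0 := fun h => by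
    rw [h, Polynomial.natDegree_zero] at hcomp
    omega
  have hlead : (f.comp u).coeff f.natDegree ≠ 0 := by
    rw [← hcomp]
    exact Polynomial.leadingCoeff_ne_zero.2 hne
  have himg : aeval (Pi.single i Polynomial.X : σ → Polynomial K)
      (affineForm b d + C β * Polynomial.aeval (affineForm a c) f) =
      (Polynomial.C (b i) * Polynomial.X + Polynomial.C d) + Polynomial.C β * f.comp u := by
    rw [map_add, map_mul, aeval_single_affineForm, ← Polynomial.aeval_algHom_apply,
      aeval_single_affineForm, aeval_C]
    rfl
  rw [himg, Polynomial.coeff_add, hlin, zero_add, Polynomial.coeff_C_mul]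
  exact mul_ne_zero hβ hlead

/-- On the `i`-th axis `u`, hence `f(u)`, is constant, so the linear coefficient `b i` survives. -/
theorem weight_le_weightedTotalDegree (w : σ → ℕ) (a b : σ → K) (c d β : K)
    (f : Polynomial K) {i : σ} (ha : a i = 0) (hb : b i ≠ 0) :
    w i ≤ weightedTotalDegree w (affineForm b d + C β * Polynomial.aeval (affineForm a c) f) := by
  classical
  refine (one_mul (w i)).symm.le.trans
    (mul_le_weightedTotalDegree_of_coeff_aeval_single w _ i 1 ?_)
  have himg : aeval (Pi.single i Polynomial.X : σ → Polynomial K)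
      (affineForm b d + C β * Polynomial.aeval (affineForm a c) f) =
      (Polynomial.C (b i) * Polynomial.X + Polynomial.C d) +
        Polynomial.C (β * f.eval c) := by
    rw [map_add, map_mul, aeval_single_affineForm, ← Polynomial.aeval_algHom_apply,
      aeval_single_affineForm, aeval_C, ha, Polynomial.C_0, zero_mul, zero_add, Polynomial.C_mul]
    congr 2
    exact Polynomial.aeval_algebraMap_apply_eq_algebraMap_eval c f
  rw [himg]
  simpa [Polynomial.coeff_C] using hb

theorem weightedTotalDegree_affineForm_add_aeval_le (w : σ → ℕ) (a b : σ → K) (c d β : K)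
    (f : Polynomial K) {N : ℕ} (hb : ∀ i, b i ≠ 0 → w i ≤ N)
    (ha : f.natDegree * weightedTotalDegree w (affineForm a c) ≤ N) :
    weightedTotalDegree w (affineForm b d + C β * Polynomial.aeval (affineForm a c) f) ≤ N :=
  (weightedTotalDegree_add_le _ _ _).trans (max_le (weightedTotalDegree_affineForm_le w b d hb)
    ((weightedTotalDegree_C_mul_le _ _ _).trans ((weightedTotalDegree_aeval_le _ _ _).trans ha)))

end Field

end MvPolynomial

/-! ### Normal forms of plane automorphisms of length at most 1 -/

namespace PolyMap

open MvPolynomial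

theorem IsAut.injective {n : ℕ} {F : PolyMap n} (hF : F.IsAut) : Function.Injective F.toFun := by
  obtain ⟨G, hG, -⟩ := hF
  intro x y hxy
  have key : ∀ z, G.toFun (F.toFun z) = z := fun z => by
    rw [← toFun_comp, hG]
    funext i
    simp [toFun, id]
  rw [← key x, hxy, key y]

theorem IsAffine.exists_affineForm {n : ℕ} {L : PolyMap n} (hL : L.IsAffine) :
    ∃ (a : Fin n → Fin n → ℂ) (c : Fin n → ℂ), ∀ i, L i = affineForm (a i) (c i) :=
  ⟨_, _, fun i => eq_affineForm_of_totalDegree_le_one (hL i).le⟩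

/-- An automorphism with affine coordinates has an invertible linear part. -/
theorem IsAut.det_ne_zero {L : PolyMap 2} (hL : L.IsAut) {a : Fin 2 → Fin 2 → ℂ} {c : Fin 2 → ℂ}
    (h : ∀ i, L i = affineForm (a i) (c i)) : a 0 0 * a 1 1 - a 0 1 * a 1 0 ≠ 0 := by
  intro hdet
  have hker : ∀ z : Fin 2 → ℂ, (∀ i, a i 0 * z 0 + a i 1 * z 1 = 0) → z = 0 := fun z hz => by
    refine hL.injective (funext fun i => ?_)
    simp [toFun, h, affineForm, hz i]
  -- Each row of the matrix kills its own rotation by a right angle, and zero determinant makes the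
  -- other row kill it too. So injectivity forces both rows to vanish.
  have h1 : ![a 1 1, -a 1 0] = 0 := hker _ fun j => by
    fin_cases j
    · simp
      linear_combination hdet
    · simp
      ring
  have h0 : ![a 0 1, -a 0 0] = 0 := hker _ fun j => by
    fin_cases j
    · simp
      ring
    · simp
      linear_combination -hdet
  have h00 : a 0 0 = 0 := by simpa using congrFun h0 1
  have h10 : a 1 0 = 0 := by simpa using congrFun h1 1
  have hz : ![(1 : ℂ), 0] = 0 := hker _ fun j => by fin_cases j <;> simp [h00, h10]
  simpa using congrFun hz 0

/-- A mapping of length at most `1` is affine, or becomes a single triangular automorphism after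
composition with affine automorphisms. -/
theorem exists_hasDecomposition_of_length_le_one {F : PolyMap 2} (h : F.length ≤ 1) :
    F.HasDecomposition 0 ∨ F.HasDecomposition 1 := by
  by_contra! hne
  -- The infimum bound also covers the value `⊤` of an empty family.
  have h2 : (2 : ℕ∞) ≤ F.length := le_iInf₂ fun l hl => by
    have : 2 ≤ l := by
      by_contra! hlt
      interval_cases l
      exacts [hne.1 hl, hne.2 hl]
    exact_mod_cast this
  exact absurd (h2.trans h) (by decide)

theorem HasDecomposition.exists_affineForm_of_zero {F : PolyMap 2} (h : F.HasDecomposition 0) :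
    ∃ (b : Fin 2 → Fin 2 → ℂ) (d : Fin 2 → ℂ), ∀ i, F i = affineForm (b i) (d i) := by
  obtain ⟨L₁, L₂, f, ⟨hL₁, -⟩, ⟨hL₂, -⟩, -, rfl⟩ := h
  obtain ⟨a, c, ha⟩ := hL₁.exists_affineForm
  obtain ⟨p, q, hp⟩ := hL₂.exists_affineForm
  refine ⟨fun i j => p i 0 * a 0 j + p i 1 * a 1 j,
    fun i => p i 0 * c 0 + p i 1 * c 1 + q i, fun i => ?_⟩
  simp only [comp, alternating, id, hp, bind₁_X_right, bind₁_C_right, ha, affineForm,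
    Fin.sum_univ_two, map_add, map_mul]
  ring

theorem HasDecomposition.exists_affineForm_of_one {F : PolyMap 2} (h : F.HasDecomposition 1) :
    ∃ (a p : Fin 2 → Fin 2 → ℂ) (c d : Fin 2 → ℂ) (f : Polynomial ℂ), 1 < f.natDegree ∧
      a 0 0 * a 1 1 - a 0 1 * a 1 0 ≠ 0 ∧ p 0 0 * p 1 1 - p 0 1 * p 1 0 ≠ 0 ∧
      ∀ i, F i = affineForm (fun j => p i 0 * a 0 j + p i 1 * a 1 j) (d i) +
        C (p i 1) * Polynomial.aeval (affineForm (a 0) (c 0)) f := by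
  obtain ⟨L₁, L₂, f, ⟨hL₁, hL₁'⟩, ⟨hL₂, hL₂'⟩, hf, rfl⟩ := h
  obtain ⟨a, c, ha⟩ := hL₁.exists_affineForm
  obtain ⟨p, q, hp⟩ := hL₂.exists_affineForm
  refine ⟨a, p, c, fun i => p i 0 * c 0 + p i 1 * c 1 + q i, f 1, hf 1 (by simp),
    hL₁'.det_ne_zero ha, hL₂'.det_ne_zero hp, fun i => ?_⟩
  have halt : ∀ i, (alternating f 1).comp L₁ i =
      ![L₁ 0, L₁ 1 + Polynomial.aeval (L₁ 0) (f 1)] i := fun i => by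
    fin_cases i <;>
      simp [comp, alternating, id, lowerTriangular, ← Polynomial.aeval_algHom_apply]
  have hcomp : L₂.comp ((alternating f 1).comp L₁) i =
      bind₁ ((alternating f 1).comp L₁) (L₂ i) := rfl
  rw [hcomp, hp, bind₁_affineForm, Fin.sum_univ_two, halt, halt]
  simp only [Matrix.cons_val_zero, Matrix.cons_val_one, ha]
  generalize Polynomial.aeval (affineForm (a 0) (c 0)) (f 1) = g
  simp only [affineForm, Fin.sum_univ_two, map_add, map_mul]
  ring

theorem weightedTotalDegree_affineForm_two (w₁ w₂ : ℕ) (a : Fin 2 → ℂ) (c : ℂ) :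
    (affineForm a c).weightedTotalDegree ![w₁, w₂] =
      max (if a 0 = 0 then 0 else w₁) (if a 1 = 0 then 0 else w₂) := by
  refine le_antisymm (weightedTotalDegree_affineForm_le _ _ _ fun i hi => ?_) (max_le ?_ ?_)
  · fin_cases i <;> simp_all
  · split_ifs with h
    · exact Nat.zero_le _
    · exact le_weightedTotalDegree_affineForm ![w₁, w₂] a c h
  · split_ifs with h
    · exact Nat.zero_le _
    · exact le_weightedTotalDegree_affineForm ![w₁, w₂] a c h

/-- The weighted degree of `b + β f(u)`, where `b` and `u` are affine with linear parts `b` and `a`. -/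
theorem weightedTotalDegree_affineForm_add_aeval_two (w₁ w₂ : ℕ) (a b : Fin 2 → ℂ) (c d β : ℂ)
    (f : Polynomial ℂ) (hβ : β ≠ 0) (hf : 1 < f.natDegree)
    (hab : ∀ i, a i = 0 → b i ≠ 0) :
    (affineForm b d + C β * Polynomial.aeval (affineForm a c) f).weightedTotalDegree ![w₁, w₂] =
      max (if a 0 = 0 then w₁ else f.natDegree * w₁)
        (if a 1 = 0 then w₂ else f.natDegree * w₂) := by
  have hmul : ∀ x : ℕ, x ≤ f.natDegree * x := fun x => Nat.le_mul_of_pos_left x (by omega)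
  refine le_antisymm (weightedTotalDegree_affineForm_add_aeval_le _ _ _ _ _ _ _ ?_ ?_)
    (max_le ?_ ?_)
  · intro i _
    have h₁ := hmul w₁
    have h₂ := hmul w₂
    fin_cases i <;> simp <;> split_ifs <;> omega
  · rw [weightedTotalDegree_affineForm_two, ← Nat.mul_max_mul_left]
    refine max_le_max ?_ ?_ <;> split_ifs <;> simp
  · split_ifs with h
    · exact weight_le_weightedTotalDegree ![w₁, w₂] a b c d β f h (hab 0 h)
    · exact natDegree_mul_le_weightedTotalDegree ![w₁, w₂] a b c d β f hβ hf h
  · split_ifs with h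
    · exact weight_le_weightedTotalDegree ![w₁, w₂] a b c d β f h (hab 1 h)
    · exact natDegree_mul_le_weightedTotalDegree ![w₁, w₂] a b c d β f hβ hf h

end PolyMap

/-! ### Case analysis of the bidegree -/

theorem theorem2 (w₁ w₂ : ℕ) (hw₁ : 0 < w₁) (hw₂ : 0 < w₂)
    (F : PolyMap 2) (hF : F.IsAut) (hlen : F.length ≤ 1) :
    F.weightedBidegree w₁ w₂ ∈
      {d : ℕ × ℕ | ∃ k : ℕ, 0 < k ∧ w₂ ≤ k * w₁ ∧
          (d = (w₁, k * w₁) ∨ d = (k * w₁, w₁) ∨ d = (k * w₁, k * w₁))} ∪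
      {d : ℕ × ℕ | ∃ k : ℕ, 0 < k ∧ w₁ ≤ k * w₂ ∧
          (d = (w₂, k * w₂) ∨ d = (k * w₂, w₂) ∨ d = (k * w₂, k * w₂))} ∪
      {(w₁, w₂), (w₂, w₁), (max w₁ w₂, max w₁ w₂)} := by
  rcases PolyMap.exists_hasDecomposition_of_length_le_one hlen with h | h
  · obtain ⟨b, d, hb⟩ := h.exists_affineForm_of_zero
    have hdet := hF.det_ne_zero hb
    simp only [PolyMap.weightedBidegree, hb, PolyMap.weightedTotalDegree_affineForm_two]
    refine Or.inr ?_
    by_cases h00 : b 0 0 = 0 <;> by_cases h01 : b 0 1 = 0 <;> by_cases h10 : b 1 0 = 0 <;>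
      by_cases h11 : b 1 1 = 0 <;> simp [h00, h01, h10, h11] at hdet ⊢
    all_goals grind
  · obtain ⟨a, p, c, d, f, hf, hadet, hpdet, hF'⟩ := h.exists_affineForm_of_one
    set E := max (if a 0 0 = 0 then 0 else w₁) (if a 0 1 = 0 then 0 else w₂) with hE
    set D := max (if a 0 0 = 0 then w₁ else f.natDegree * w₁)
      (if a 0 1 = 0 then w₂ else f.natDegree * w₂) with hD
    have h0 : ∀ i, p i 1 = 0 → (F i).weightedTotalDegree ![w₁, w₂] = E := fun i hi => by
      have hi0 : p i 0 ≠ 0 := fun h => by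
        fin_cases i <;> simp_all
      simp [hF', hi, PolyMap.weightedTotalDegree_affineForm_two, hi0, hE]
    have h1 : ∀ i, p i 1 ≠ 0 → (F i).weightedTotalDegree ![w₁, w₂] = D := fun i hi => by
      rw [hF']
      refine PolyMap.weightedTotalDegree_affineForm_add_aeval_two w₁ w₂ _ _ _ _ _ _ hi hf ?_
      intro j hj
      -- The determinant of `L₁` is nonzero, so when `u` misses a variable the second coordinate of
      -- `L₁` involves it.
      have : a 1 j ≠ 0 := fun h => by fin_cases j <;> simp_all
      simp [hj, hi, this]
    have hdeg : F.weightedBidegree w₁ w₂ = (E, D) ∨ F.weightedBidegree w₁ w₂ = (D, E) ∨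
        F.weightedBidegree w₁ w₂ = (D, D) := by
      by_cases hp0 : p 0 1 = 0 <;> by_cases hp1 : p 1 1 = 0
      · simp [hp0, hp1] at hpdet
      · simp [PolyMap.weightedBidegree, h0 0 hp0, h1 1 hp1]
      · simp [PolyMap.weightedBidegree, h1 0 hp0, h0 1 hp1]
      · simp [PolyMap.weightedBidegree, h1 0 hp0, h1 1 hp1]
    have hk : 0 < f.natDegree := by omega
    have hle : ∀ x, x ≤ f.natDegree * x := fun x => Nat.le_mul_of_pos_left x hk
    -- If `u` involves only one variable, the other may still dominate `D`; this gives the last two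
    -- alternatives, without a factor `k`.
    have hshape : (E = w₁ ∧ D = f.natDegree * w₁ ∧ w₂ ≤ D) ∨
        (E = w₂ ∧ D = f.natDegree * w₂ ∧ w₁ ≤ D) ∨
        (E = w₁ ∧ D = w₂ ∧ w₁ ≤ w₂) ∨ (E = w₂ ∧ D = w₁ ∧ w₂ ≤ w₁) := by
      have hle₁ := hle w₁
      have hle₂ := hle w₂
      by_cases ha0 : a 0 0 = 0 <;> by_cases ha1 : a 0 1 = 0
      · simp [ha0, ha1] at hadet
      · simp only [ha0, ha1, if_true, if_false] at hE hD
        omega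
      · simp only [ha0, ha1, if_true, if_false] at hE hD
        omega
      · simp only [ha0, ha1, if_false] at hE hD
        rcases le_total w₁ w₂ with h | h
        · have := Nat.mul_le_mul_left f.natDegree h
          omega
        · have := Nat.mul_le_mul_left f.natDegree h
          omega
    rcases hshape with ⟨hE', hD', hw⟩ | ⟨hE', hD', hw⟩ | ⟨hE', hD', hw⟩ | ⟨hE', hD', hw⟩
    · refine Or.inl (Or.inl ⟨f.natDegree, hk, hD' ▸ hw, ?_⟩)
      rwa [hE', hD'] at hdeg
    · refine Or.inl (Or.inr ⟨f.natDegree, hk, hD' ▸ hw, ?_⟩)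
      rwa [hE', hD'] at hdeg
    · refine Or.inr ?_
      rw [hE', hD'] at hdeg
      rw [max_eq_right hw]
      exact hdeg
    · refine Or.inr ?_
      rw [hE', hD'] at hdeg
      rw [max_eq_left hw, Set.mem_insert_iff, Set.mem_insert_iff]
      tauto
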